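/- Let $D\ge 0$ be an even integer. For integers $a,b$ put $[a,b]=\{z\in\mathbb Z: a\le z\le b\}$; an interval of $[1,D]$ is a set $[a,b]$ with $1\le a\le b\le D$. For $D\ge 2$, $i\in[1,D]$ and an interval $[a,b]$ of $[1,D-2]$ let $\xi_i([a,b])$ be $[a+2,b+2]$ if $i\le a$, $[a,b]$ if $i\ge b+2$, and $[a,b+2]$ if $a<i<b+2$. Define sets $\mathbf S_D$, whose elements are sets of intervals of $[1,D]$, by induction on the even integer $D$: $\mathbf S_0=\{\emptyset\}$, and for $D\ge 2$ the set $\mathbf S_D$ consists of the sets $\{[1,D],[2,D-1],\dots,[k,D+1-k]\}$ with $0\le k\le D/2$ and of the sets $\{\xi_i(I): I\in B'\}\sqcup\{\{i\}\}$ with $i\in[1,D]$ and $B'\in\mathbf S_{D-2}$. For $B\in\mathbf S_D$, $h\in\{0,1\}$ and $j\in[1,D]$ let $B^h=\{I\in B: |I|\equiv h \bmod 2\}$ and $B^h_j=\{I\in B^h: j\in I\}$, let $\kappa\in\{0,1\}$ be the parity of $|B^0|$, and put $f_j(B)=|B^1_j|-|B^0_j|-\kappa\in\mathbb Z$. Let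 $V$ be the $\mathbb F_2$-vector space with basis $e_1,\dots,e_D$, put $e_I=\sum_{i\in I}e_i$ for $I\subset[1,D]$, and define $\epsilon:\mathbf S_D\to V$ by $\epsilon(B)=\sum_{j=1}^{D}\epsilon_j(B)e_j$, where $\epsilon_j(B)\in\mathbb F_2$ is the class of $f_j(B)(f_j(B)+1)/2$ modulo $2$. Let $\langle B\rangle\subset V$ be the span of $\{e_I: I\in B\}$, let $\Psi_B:V\to\mathbb C$ be the characteristic function of $\langle B\rangle$, and for $x\in V$ let $\psi_x:V\to\mathbb C$ be the characteristic function of $\{x\}$. For $B,\tilde B\in\mathbf S_D$ write $B\le\tilde B$ if either $|B^0|<|\tilde B^0|$, or $|B^0|=|\tilde B^0|$ and $f_i(B)\le f_i(\tilde B)$ for all $i\in[1,D]$. Then $\epsilon$ is a bijection, the functions $\Psi_B$ $(B\in\mathbf S_D)$ form a basis of the $\mathbb C$-vector space of all functions $V\to\mathbb C$, and the relation on $V$ defined by $x\le\tilde x$ if and only if $\epsilon^{-1}(x)\le\epsilon^{-1}(\tilde x)$ is a partial order. Consequently there are unique coefficients $c_{x,\tilde x}\in\mathbb C$ $(x,\tilde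 x\in V)$ with $$\psi_x=\sum_{\tilde x\in V}c_{x,\tilde x}\,\Psi_{\epsilon^{-1}(\tilde x)}\qquad\text{for all }x\in V,$$ and they satisfy: if $c_{x,\tilde x}\neq 0$ then $\tilde x\le x$; moreover $c_{x,x}=1$ for all $x\in V$. -/

import Mathlib

/-! An interval `[a, b]` (with `1 ≤ a ≤ b ≤ D`) is encoded by the pair `(a, b)` of its endpoints,
so a set of intervals is a `Finset (ℕ × ℕ)`. -/

namespace NewBasis

/-- The map `ξ_i` from intervals of `[1, D - 2]` to intervals of `[1, D]`. -/
def xi (i : ℕ) (I : ℕ × ℕ) : ℕ × ℕ :=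
  if i ≤ I.1 then (I.1 + 2, I.2 + 2)
  else if I.2 + 2 ≤ i then (I.1, I.2)
  else (I.1, I.2 + 2)

/-- The map `t_i`: apply `ξ_i` to all intervals and add the one-element interval `{i}`. -/
def t (i : ℕ) (B : Finset (ℕ × ℕ)) : Finset (ℕ × ℕ) :=
  insert (i, i) (B.image (xi i))

/-- The primitive set of intervals `{[1, D], [2, D - 1], …, [k, D + 1 - k]}`. -/
def prim (D k : ℕ) : Finset (ℕ × ℕ) :=
  (Finset.Icc 1 k).image fun j => (j, D + 1 - j)

/-- `IsS D B` says that `D` is even and that `B` belongs to the set `𝐒_D`, which is defined by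
induction on `D`. -/
inductive IsS : ℕ → Finset (ℕ × ℕ) → Prop
  | primitive (D k : ℕ) (hD : Even D) (hk : k ≤ D / 2) : IsS D (prim D k)
  | step (D i : ℕ) (B : Finset (ℕ × ℕ)) (hB : IsS D B) (hi : i ∈ Finset.Icc 1 (D + 2)) :
      IsS (D + 2) (t i B)

/-- The set `𝐒_D`. -/
abbrev S (D : ℕ) : Type := {B : Finset (ℕ × ℕ) // IsS D B}

/-- `B^h`: the intervals `[a, b]` of `B` whose number of elements `b + 1 - a` is congruent to `h`
modulo 2. -/
def part (B : Finset (ℕ × ℕ)) (h : ℕ) : Finset (ℕ × ℕ) :=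
  B.filter fun I => (I.2 + 1 - I.1) ≡ h [MOD 2]

/-- `B^h_j`: the intervals in `B^h` that contain `j`. -/
def partAt (B : Finset (ℕ × ℕ)) (h j : ℕ) : Finset (ℕ × ℕ) :=
  (part B h).filter fun I => j ∈ Finset.Icc I.1 I.2

/-- `f_j(B) = |B^1_j| - |B^0_j| - κ`, where `κ ∈ {0, 1}` is the parity of `|B^0|`. -/
def f (B : Finset (ℕ × ℕ)) (j : ℕ) : ℤ :=
  ((partAt B 1 j).card : ℤ) - ((partAt B 0 j).card : ℤ) - (((part B 0).card % 2 : ℕ) : ℤ)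

/-- The `𝔽₂`-vector space with basis `e_i`, `i ∈ [1, D]`. -/
abbrev V (D : ℕ) : Type := {i : ℕ // i ∈ Finset.Icc 1 D} → ZMod 2

/-- `e_I = ∑_{i ∈ I} e_i`. -/
def eI (D : ℕ) (I : ℕ × ℕ) : V D :=
  ∑ i : {i : ℕ // i ∈ Finset.Icc 1 D}, if (i : ℕ) ∈ Finset.Icc I.1 I.2 then Pi.single i 1 else 0

/-- `ε(B) = ∑_j ε_j(B) e_j`, where `ε_j(B)` is `f_j(B) (f_j(B) + 1) / 2` modulo 2
(the integer division is exact). -/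
def eps {D : ℕ} (B : S D) : V D :=
  fun j => ((f B.1 j * (f B.1 j + 1) / 2 : ℤ) : ZMod 2)

/-- `⟨B⟩`: the subspace of `V` spanned by the vectors `e_I`, `I ∈ B`. -/
def spanB {D : ℕ} (B : S D) : Submodule (ZMod 2) (V D) :=
  Submodule.span (ZMod 2) (eI D '' (B.1 : Set (ℕ × ℕ)))

/-- `ψ_x`: the characteristic function of the point `x`. -/
noncomputable def psi {D : ℕ} (x : V D) : V D → ℂ :=
  Set.indicator {x} 1

/-- `Ψ_B`: the characteristic function of `⟨B⟩`. -/
noncomputable def Psi {D : ℕ} (B : S D) : V D → ℂ :=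
  Set.indicator (spanB B : Set (V D)) 1

/-- The relation `B ≤ B'` on `𝐒_D`. -/
def leS {D : ℕ} (B B' : S D) : Prop :=
  (part B.1 0).card < (part B'.1 0).card ∨
    ((part B.1 0).card = (part B'.1 0).card ∧ ∀ i ∈ Finset.Icc 1 D, f B.1 i ≤ f B'.1 i)

/-- The relation `x ≤ x'` on `V` obtained by transport along a bijection `e : 𝐒_D ≃ V`
(in use, `e` is `ε`). -/
def leV {D : ℕ} (e : S D ≃ V D) (x x' : V D) : Prop :=
  leS (e.symm x) (e.symm x')

/-- `c` is a matrix of coefficients expressing every `ψ_x` through the functions `Ψ_{e⁻¹(x')}`. -/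
def IsExpansion {D : ℕ} (e : S D ≃ V D) (c : V D → V D → ℂ) : Prop :=
  ∀ x : V D, psi x = ∑ x' : V D, c x x' • Psi (e.symm x')

end NewBasis

/-! Let `K` be the number of even intervals of `B`. Extended to positions `0, …, D + 1`, the
sequence `f B` is a walk with steps `±1` that starts and ends at `-(K % 2)`, stays above the even
floor `-K - K % 2`, and may rest only at the floor. A primitive collection gives a valley with a
flat bottom, and `t i` inserts a peak `v, v + 1, v` at position `i`. Every walk without peaks is
such a valley, and any peak of `f B` can be taken as the last one inserted. Hence collections
correspond exactly to walks (`Walk.exists_isS`, `IsS.unique`).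

From each admissible value a walk has two continuations, and `tri` separates them: it changes under
`v ↦ v + 2`, and under `v ↦ v + 1` for even `v`. So for given `K` the classes `tri (g j)` determine
the walk, and `tri (g (i - 1)) = tri (g (i + 1))` forces `g (i - 1) = g (i + 1)`. Deleting entries
`i, i + 1` at such coincidences, on walks and on vectors alike, shows that each vector comes from
exactly one walk (`Walk.index_unique`, `exists_walk`); thus `ε` is bijective.

The same deletion describes spans: `x` lies in `⟨t i B⟩` iff `x_{i-1} = x_{i+1}` and the contracted
vector lies in `⟨B⟩`, with `x_0 = x_{D+1} = 0` understood at the ends. Induction gives `ε(B) ∈ ⟨B⟩`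
(`IsS.mem_spanOf`) and `B' ≤ B` whenever `ε(B') ∈ ⟨B⟩` (`IsS.walk_le`). The matrix of the values
`Ψ_B(ε(B'))` is therefore unitriangular, and so is its inverse, the matrix `c`. -/

namespace NewBasis

/-! ### Triangular numbers modulo 2 and single steps -/

/-- The triangular number `v (v + 1) / 2` modulo 2. -/
def tri (v : ℤ) : ZMod 2 := ((v * (v + 1) / 2 : ℤ) : ZMod 2)

lemma tri_eq_ite (v : ℤ) : tri v = if v % 4 = 1 ∨ v % 4 = 2 then 1 else 0 := by
  have key : ∀ m : ℤ, tri (4 * m) = 0 ∧ tri (4 * m + 1) = 1 ∧ tri (4 * m + 2) = 1 ∧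
      tri (4 * m + 3) = 0 := by
    intro m
    have h2 : (2 : ZMod 2) = 0 := by decide
    refine ⟨?_, ?_, ?_, ?_⟩ <;> unfold tri
    · rw [show 4 * m * (4 * m + 1) = 2 * (2 * (m * (4 * m + 1))) by ring,
        Int.mul_ediv_cancel_left _ two_ne_zero]
      push_cast; rw [h2]; ring
    · rw [show (4 * m + 1) * (4 * m + 1 + 1) = 2 * (2 * (4 * m * m + 3 * m) + 1) by ring,
        Int.mul_ediv_cancel_left _ two_ne_zero]
      push_cast; rw [h2]; ring
    · rw [show (4 * m + 2) * (4 * m + 2 + 1) = 2 * (2 * (4 * m * m + 5 * m + 1) + 1) by ring,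
        Int.mul_ediv_cancel_left _ two_ne_zero]
      push_cast; rw [h2]; ring
    · rw [show (4 * m + 3) * (4 * m + 3 + 1) = 2 * (2 * (4 * m * m + 7 * m + 3)) by ring,
        Int.mul_ediv_cancel_left _ two_ne_zero]
      push_cast; rw [h2]; ring
  obtain ⟨h0, h1, h2, h3⟩ := key (v / 4)
  have hv := Int.mul_ediv_add_emod v 4
  have : v % 4 = 0 ∨ v % 4 = 1 ∨ v % 4 = 2 ∨ v % 4 = 3 := by omega
  rcases this with h | h | h | h <;> rw [h] at hv <;> simp only [h] <;> norm_num
  · rw [← hv, add_zero]; exact h0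
  · rw [← hv]; exact h1
  · rw [← hv]; exact h2
  · rw [← hv]; exact h3

lemma tri_eq_iff (v w : ℤ) :
    tri v = tri w ↔ ((v % 4 = 1 ∨ v % 4 = 2) ↔ (w % 4 = 1 ∨ w % 4 = 2)) := by
  rw [tri_eq_ite, tri_eq_ite]
  split_ifs with h h' h' <;> simp [h, h']

lemma zmod_two_eq_of_ne {a b c : ZMod 2} (h : a ≠ c) (h' : b ≠ c) : a = b := by
  revert a b c; decide

/-- One step of a walk on the integers `≥ c`: up, down, or resting at the floor `c`. -/
def Step (c v w : ℤ) : Prop :=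
  c ≤ v ∧ c ≤ w ∧ (w = v + 1 ∨ w = v - 1 ∨ (w = v ∧ v = c))

lemma Step.symm {c v w : ℤ} (h : Step c v w) : Step c w v := by
  unfold Step at *; omega

/-- The two candidates are `v - 1, v + 1` above the floor and `c, c + 1` on it. The second pair is
separated by `tri` only because `c` is even. -/
lemma Step.unique {c v w w' : ℤ} (hc : Even c) (h : Step c v w) (h' : Step c v w')
    (e : tri w = tri w') : w = w' := by
  rw [tri_eq_iff] at e
  rw [Int.even_iff] at hc
  unfold Step at *
  omega

lemma Step.exists {c v : ℤ} (hc : Even c) (h : c ≤ v) (a : ZMod 2) :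
    ∃ w, Step c v w ∧ tri w = a := by
  have key : ∃ w w', Step c v w ∧ Step c v w' ∧ tri w ≠ tri w' := by
    rw [Int.even_iff] at hc
    rcases h.eq_or_lt with h | h
    · refine ⟨v, v + 1, by unfold Step; omega, by unfold Step; omega, ?_⟩
      rw [Ne, tri_eq_iff]; omega
    · refine ⟨v - 1, v + 1, by unfold Step; omega, by unfold Step; omega, ?_⟩
      rw [Ne, tri_eq_iff]; omega
  obtain ⟨w, w', h1, h2, h3⟩ := key
  by_cases e : tri w = a
  · exact ⟨w, h1, e⟩
  · exact ⟨w', h2, zmod_two_eq_of_ne h3.symm (Ne.symm e)⟩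

/-! ### Walks, insertion and deletion -/

/-- The floor of the walks attached to collections with `K` intervals of even size. -/
def floor (K : ℕ) : ℤ := -(K : ℤ) - ((K % 2 : ℕ) : ℤ)

lemma even_floor (K : ℕ) : Even (floor K) := by
  rw [Int.even_iff]; unfold floor; omega

/-- Walks `g 0, …, g (D + 1)` starting and ending at minus the parity of `K`, with floor
`floor K`. -/
structure Walk (D K : ℕ) (g : ℕ → ℤ) : Prop where
  start : g 0 = -((K % 2 : ℕ) : ℤ)
  final : g (D + 1) = -((K % 2 : ℕ) : ℤ)
  step : ∀ j ≤ D, Step (floor K) (g j) (g (j + 1))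

/-- Remove the entries `i` and `i + 1` of a sequence. -/
def del {α : Type*} (i : ℕ) (g : ℕ → α) : ℕ → α := fun j => if j < i then g j else g (j + 2)

/-- Replace the entry `v` of a sequence at `i - 1` by `v, w, v`. -/
def ins {α : Type*} (i : ℕ) (w : α) (g : ℕ → α) : ℕ → α :=
  fun j => if j < i then g j else if j = i then w else g (j - 2)

lemma Walk.floor_le {D K : ℕ} {g : ℕ → ℤ} (h : Walk D K g) {j : ℕ} (hj : j ≤ D + 1) :
    floor K ≤ g j := by
  rcases hj.eq_or_lt with rfl | hj
  · exact (h.step D le_rfl).2.1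
  · exact (h.step j (by omega)).1

lemma Walk.ins {D K : ℕ} {g : ℕ → ℤ} (h : Walk D K g) {i : ℕ} (hi : 1 ≤ i) (hi' : i ≤ D + 2)
    {w : ℤ} (hw : Step (floor K) (g (i - 1)) w) : Walk (D + 2) K (ins i w g) where
  start := by simp [NewBasis.ins, show 0 < i by omega, h.start]
  final := by
    simp [NewBasis.ins, show ¬ (D + 2 + 1 < i) by omega, show ¬ (D + 2 + 1 = i) by omega, h.final]
  step := by
    intro j hj
    unfold NewBasis.ins
    rcases lt_trichotomy (j + 1) i with h1 | h1 | h1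
    · rw [if_pos (by omega), if_pos h1]; exact h.step j (by omega)
    · subst h1
      rw [if_pos (by omega), if_neg (by omega), if_pos rfl]; exact hw
    · rw [if_neg (show ¬ j < i by omega), if_neg (show ¬ j + 1 < i by omega),
        if_neg (show ¬ j + 1 = i by omega)]
      split_ifs with h2
      · subst h2; exact hw.symm
      · have := h.step (j - 2) (by omega)
        rwa [show j + 1 - 2 = j - 2 + 1 by omega]

lemma Walk.del {D K : ℕ} {g : ℕ → ℤ} (h : Walk (D + 2) K g) {i : ℕ} (hi : 1 ≤ i)
    (hi' : i ≤ D + 2) (e : g (i - 1) = g (i + 1)) : Walk D K (del i g) where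
  start := by simp [NewBasis.del, show 0 < i by omega, h.start]
  final := by
    unfold NewBasis.del
    split_ifs with h1
    · obtain rfl : i = D + 2 := by omega
      exact e.trans h.final
    · exact h.final
  step := by
    intro j hj
    unfold NewBasis.del
    rcases lt_trichotomy (j + 1) i with h1 | h1 | h1
    · rw [if_pos (by omega), if_pos h1]; exact h.step j (by omega)
    · subst h1
      rw [if_pos (by omega), if_neg (by omega)]
      rw [Nat.add_sub_cancel] at e
      rw [e]
      exact h.step (j + 2) (by omega)
    · rw [if_neg (by omega), if_neg (by omega)]
      exact h.step (j + 2) (by omega)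

/-- Both outer values are one step away from `g i`, so uniqueness of steps applies, read backwards
on the left. -/
lemma Walk.eq_of_tri_eq {D K : ℕ} {g : ℕ → ℤ} (h : Walk D K g) {i : ℕ} (hi : 1 ≤ i)
    (hi' : i ≤ D) (e : tri (g (i - 1)) = tri (g (i + 1))) : g (i - 1) = g (i + 1) := by
  have h1 := h.step (i - 1) (by omega)
  rw [Nat.sub_add_cancel hi] at h1
  exact h1.symm.unique (even_floor K) (h.step i hi') e

lemma ins_del {i : ℕ} {g : ℕ → ℤ} (hi : 1 ≤ i) (e : g (i - 1) = g (i + 1)) :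
    ins i (g i) (del i g) = g := by
  funext j
  unfold ins del
  rcases lt_trichotomy j i with h | h | h
  · simp [h]
  · simp [h]
  · rw [if_neg (by omega), if_neg (by omega)]
    split_ifs with h2
    · obtain rfl : j = i + 1 := by omega
      exact e
    · congr 1; omega

lemma Walk.abs_sub_le {D K : ℕ} {g : ℕ → ℤ} (h : Walk D K g) (i n : ℕ) (hn : i + n ≤ D + 1) :
    g (i + n) ≤ g i + n ∧ g i ≤ g (i + n) + n := by
  induction n with
  | zero => simp
  | succ n ih =>
    have := ih (by omega)
    have h2 := h.step (i + n) (by omega)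
    unfold Step at h2
    rw [← add_assoc]
    push_cast
    omega

/-! ### Valleys and walks without peaks -/

/-- The sequence `f` attached to a primitive collection of `k` intervals. -/
def profile (D k j : ℕ) : ℤ := -((k % 2 : ℕ) : ℤ) - ((min k (min j (D + 1 - j)) : ℕ) : ℤ)

lemma walk_profile {D k : ℕ} (hk : k ≤ D / 2) : Walk D k (profile D k) where
  start := by simp [profile]
  final := by simp [profile]
  step := by
    intro j hj
    unfold Step profile floor
    omega

/-- A closed walk with `D + 1` steps, an odd number, cannot consist of steps `±1` only. -/
lemma Walk.exists_flat {D K : ℕ} {g : ℕ → ℤ} (hD : Even D) (h : Walk D K g) :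
    ∃ j ≤ D, g j = floor K ∧ g (j + 1) = floor K := by
  by_contra! hc
  have key : ∀ j ≤ D + 1, (g j - g 0 - j) % 2 = 0 := by
    intro j
    induction j with
    | zero => simp
    | succ j ih =>
      intro hj
      have h1 := ih (by omega)
      have h2 := h.step j (by omega)
      have h3 := hc j (by omega)
      unfold Step at h2
      push_cast
      omega
  have := key (D + 1) le_rfl
  rw [h.final, h.start] at this
  rw [Nat.even_iff] at hD
  push_cast at this
  omega

/-- The floor lies `K` below both endpoints, so a rest there needs `K` steps before it and `K` after
it. -/
lemma Walk.le_half {D K : ℕ} {g : ℕ → ℤ} (hD : Even D) (h : Walk D K g) : K ≤ D / 2 := by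
  obtain ⟨j, hj, h1, h2⟩ := h.exists_flat hD
  have a := h.abs_sub_le 0 j (by omega)
  have b := h.abs_sub_le (j + 1) (D - j) (by omega)
  rw [show j + 1 + (D - j) = D + 1 by omega, h.final, h2] at b
  rw [zero_add, h.start, h1] at a
  unfold floor at a b
  omega

/-- A walk without peaks is a valley with a flat bottom. -/
lemma Walk.eq_profile {D K : ℕ} {g : ℕ → ℤ} (h : Walk D K g)
    (hp : ∀ i, 1 ≤ i → i ≤ D → g i = g (i - 1) + 1 → g (i + 1) ≠ g (i - 1)) :
    ∀ j ≤ D + 1, g j = profile D K j := by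
  -- Without peaks, an ascent can never stop before the right end; symmetrically, a descending step
  -- is preceded only by descending steps.
  have up : ∀ n j, j + n = D → g (j + 1) = g j + 1 → g (D + 1) = g j + n + 1 := by
    intro n
    induction n with
    | zero => intro j hj e; simp_all
    | succ n ih =>
      intro j hj e
      have h1 := hp (j + 1) (by omega) (by omega) (by simpa using e)
      have h0 := h.step j (by omega)
      have h2 := h.step (j + 1) (by omega)
      unfold Step at h0 h2
      rw [Nat.add_sub_cancel] at h1
      have := ih (j + 1) (by omega) (by omega)
      push_cast
      omega
  have down : ∀ j ≤ D, g (j + 1) = g j - 1 → g j = g 0 - j := by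
    intro j
    induction j with
    | zero => simp
    | succ n ih =>
      intro hj e
      have h1 := hp (n + 1) (by omega) (by omega)
      have h0 := h.step n (by omega)
      have h2 := h.step (n + 1) (by omega)
      unfold Step at h0 h2
      rw [Nat.add_sub_cancel] at h1
      have := ih (by omega)
      push_cast
      omega
  intro j hj
  have a := (h.abs_sub_le 0 j (by omega)).2
  have b := (h.abs_sub_le j (D + 1 - j) (by omega)).1
  rw [Nat.add_sub_cancel' hj, h.final] at b
  rw [zero_add, h.start] at a
  have c := h.floor_le hj
  have d : g j = floor K ∨ g j = g 0 - j ∨ g j = g (D + 1) - (D + 1 - j) := by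
    rcases j with _ | n
    · simp
    · have h0 := h.step n (by omega)
      have h1 := down n (by omega)
      have h2 := up (D - n) n (by omega)
      unfold Step at h0
      push_cast
      omega
  rw [h.start, h.final] at d
  unfold profile
  unfold floor at c d
  omega

/-! ### Every vector comes from a unique walk -/

lemma Walk.eq_half {D K : ℕ} {g : ℕ → ℤ} (hD : Even D) (h : Walk D K g)
    (hp : ∀ i, 1 ≤ i → i ≤ D → tri (g (i - 1)) ≠ tri (g (i + 1))) : K = D / 2 := by
  have h1 := h.le_half hD
  have h2 := h.eq_profile fun i hi hi' _ e => hp i hi hi' (by rw [e])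
  by_contra hne
  -- If `K < D / 2`, the flat bottom of the valley contains both `K` and `K + 2`.
  refine hp (K + 1) (by omega) (by omega) ?_
  rw [h2 _ (by omega), h2 _ (by omega)]
  congr 1
  unfold profile
  omega

/-- A coincidence at `i - 1, i + 1` is visible in the `tri` values, so it can be deleted from both
walks at once. When none is left, both indices equal `D / 2`. -/
lemma Walk.index_unique {D : ℕ} (hD : Even D) {K K' : ℕ} {g g' : ℕ → ℤ} (h : Walk D K g)
    (h' : Walk D K' g') (e : ∀ j ≤ D + 1, tri (g j) = tri (g' j)) : K = K' := by
  induction D using Nat.strong_induction_on generalizing g g' with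
  | _ D ih =>
    by_cases hp : ∀ i, 1 ≤ i → i ≤ D → tri (g (i - 1)) ≠ tri (g (i + 1))
    · rw [h.eq_half hD hp, h'.eq_half hD]
      intro i hi hi'
      rw [← e _ (by omega), ← e _ (by omega)]
      exact hp i hi hi'
    · push Not at hp
      obtain ⟨i, hi, hi', e'⟩ := hp
      obtain ⟨D, rfl⟩ : ∃ D', D = D' + 2 := ⟨D - 2, by rw [Nat.even_iff] at hD; omega⟩
      have e'' : tri (g' (i - 1)) = tri (g' (i + 1)) := by
        rw [← e _ (by omega), ← e _ (by omega)]; exact e'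
      refine ih D (by omega) (by simpa [Nat.even_add] using hD)
        (h.del hi hi' (h.eq_of_tri_eq hi hi' e')) (h'.del hi hi' (h'.eq_of_tri_eq hi hi' e'')) ?_
      intro j hj
      unfold NewBasis.del
      split_ifs
      · exact e _ (by omega)
      · exact e _ (by omega)

lemma Walk.unique {D K : ℕ} {g g' : ℕ → ℤ} (h : Walk D K g)
    (h' : Walk D K g') (e : ∀ j ≤ D + 1, tri (g j) = tri (g' j)) : ∀ j ≤ D + 1, g j = g' j := by
  intro j
  induction j with
  | zero => intro _; rw [h.start, h'.start]
  | succ j ih =>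
    intro hj
    have h1 := h.step j (by omega)
    rw [ih (by omega)] at h1
    exact h1.unique (even_floor K) (h'.step j (by omega)) (e _ hj)

lemma tri_neg_parity (K : ℕ) : tri (-((K % 2 : ℕ) : ℤ)) = 0 := by
  rw [tri_eq_ite, if_neg (by omega)]

lemma exists_walk {D : ℕ} (hD : Even D) (x : ℕ → ZMod 2) (h0 : x 0 = 0) (h1 : x (D + 1) = 0) :
    ∃ K g, Walk D K g ∧ ∀ j ≤ D + 1, tri (g j) = x j := by
  induction D using Nat.strong_induction_on generalizing x with
  | _ D ih =>
    by_cases hp : ∀ i, 1 ≤ i → i ≤ D → x (i - 1) ≠ x (i + 1)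
    · have hw : Walk D (D / 2) (profile D (D / 2)) := walk_profile le_rfl
      have hD2 := Nat.even_iff.1 hD
      have alt : ∀ i, i + 2 ≤ D + 1 →
          tri (profile D (D / 2) i) ≠ tri (profile D (D / 2) (i + 2)) := by
        intro i hi
        rw [Ne, tri_eq_iff]
        unfold profile
        omega
      -- Both sequences alternate at distance two and vanish at `0` and `D + 1`. As `D + 1` is odd,
      -- steps of two from `0` reach the even positions, and from `D + 1` the odd ones.
      have fwd : ∀ m, 2 * m ≤ D + 1 → tri (profile D (D / 2) (2 * m)) = x (2 * m) := by
        intro m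
        induction m with
        | zero => intro _; rw [mul_zero, hw.start, tri_neg_parity, h0]
        | succ m ihm =>
          intro hm
          have a := alt (2 * m) (by omega)
          have b := hp (2 * m + 1) (by omega) (by omega)
          rw [ihm (by omega)] at a
          rw [Nat.add_sub_cancel] at b
          exact zmod_two_eq_of_ne a.symm b.symm
      have bwd : ∀ m, 2 * m ≤ D + 1 →
          tri (profile D (D / 2) (D + 1 - 2 * m)) = x (D + 1 - 2 * m) := by
        intro m
        induction m with
        | zero => intro _; rw [mul_zero, Nat.sub_zero, hw.final, tri_neg_parity, h1]
        | succ m ihm =>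
          intro hm
          have a := alt (D + 1 - 2 * (m + 1)) (by omega)
          have b := hp (D + 1 - 2 * (m + 1) + 1) (by omega) (by omega)
          rw [show D + 1 - 2 * (m + 1) + 2 = D + 1 - 2 * m by omega, ihm (by omega)] at a
          rw [Nat.add_sub_cancel,
            show D + 1 - 2 * (m + 1) + 1 + 1 = D + 1 - 2 * m by omega] at b
          exact zmod_two_eq_of_ne a b
      refine ⟨D / 2, _, hw, fun j hj => ?_⟩
      rcases Nat.even_or_odd' j with ⟨m, rfl | rfl⟩
      · exact fwd m hj
      · have := bwd ((D - 2 * m) / 2) (by omega)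
        rwa [show D + 1 - 2 * ((D - 2 * m) / 2) = 2 * m + 1 by omega] at this
    · push Not at hp
      obtain ⟨i, hi, hi', e'⟩ := hp
      obtain ⟨D, rfl⟩ : ∃ D', D = D' + 2 := ⟨D - 2, by rw [Nat.even_iff] at hD; omega⟩
      obtain ⟨K, g, hg, e⟩ := ih D (by omega) (by simpa [Nat.even_add] using hD) (NewBasis.del i x)
        (by simp [del, h0, show 0 < i by omega])
        (by
          unfold del
          split_ifs with h2
          · obtain rfl : i = D + 2 := by omega
            exact e'.trans h1
          · exact h1)
      -- The deleted coordinate `x i` selects one of the two admissible values to insert.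
      obtain ⟨w, hw, hw'⟩ := Step.exists (even_floor K)
        (hg.floor_le (show i - 1 ≤ D + 1 by omega)) (x i)
      refine ⟨K, _, hg.ins hi hi' hw, fun j hj => ?_⟩
      unfold ins
      split_ifs with h2 h3
      · rw [e j (by omega), del, if_pos h2]
      · rw [hw', h3]
      · rw [e (j - 2) (by omega), del]
        split_ifs with h4
        · obtain rfl : j = i + 1 := by omega
          exact e'
        · congr 1; omega


/-! ### Effect of `t i` on the sequence `f` -/

lemma xi_injective (i : ℕ) : Function.Injective (xi i) := by
  rintro ⟨a, b⟩ ⟨c, d⟩ h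
  unfold xi at h
  dsimp only at h
  split_ifs at h <;> simp only [Prod.mk.injEq] at h ⊢ <;> omega

lemma singleton_notMem_image_xi (i : ℕ) (B : Finset (ℕ × ℕ)) : (i, i) ∉ B.image (xi i) := by
  rw [Finset.mem_image]
  rintro ⟨⟨a, b⟩, -, h⟩
  unfold xi at h
  dsimp only at h
  split_ifs at h <;> simp only [Prod.mk.injEq] at h <;> omega

/-- Non-adjacent peaks can be inserted in either order, up to a shift by two. -/
lemma t_comm {i j : ℕ} (h : i ≤ j) (B : Finset (ℕ × ℕ)) : t i (t j B) = t (j + 2) (t i B) := by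
  have e1 : xi i (j, j) = (j + 2, j + 2) := by simp [xi, h]
  have e2 : xi (j + 2) (i, i) = (i, i) := by
    simp [xi, show ¬ j + 2 ≤ i by omega, h]
  have e3 : xi i ∘ xi j = xi (j + 2) ∘ xi i := by
    funext ⟨a, b⟩
    simp only [Function.comp, xi]
    split_ifs <;> simp only [Prod.mk.injEq] at * <;> omega
  unfold t
  rw [Finset.image_insert, Finset.image_insert, e1, e2, Finset.image_image, Finset.image_image,
    e3, Finset.insert_comm]

lemma IsS.bounds {D : ℕ} {B : Finset (ℕ × ℕ)} (h : IsS D B) :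
    ∀ I ∈ B, 1 ≤ I.1 ∧ I.1 ≤ I.2 ∧ I.2 ≤ D := by
  induction h with
  | primitive D k hD hk =>
    intro I hI
    simp only [prim, Finset.mem_image, Finset.mem_Icc] at hI
    obtain ⟨j, hj, rfl⟩ := hI
    dsimp only
    omega
  | step D i B hB hi ih =>
    intro I hI
    rw [Finset.mem_Icc] at hi
    simp only [t, Finset.mem_insert, Finset.mem_image] at hI
    rcases hI with rfl | ⟨J, hJ, rfl⟩
    · exact ⟨hi.1, le_rfl, hi.2⟩
    · have := ih J hJ
      unfold xi
      split_ifs <;> dsimp only <;> omega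

lemma IsS.even {D : ℕ} {B : Finset (ℕ × ℕ)} (h : IsS D B) : Even D := by
  induction h with
  | primitive D k hD hk => exact hD
  | step D i B hB hi ih => exact ih.add even_two

/-- `ξ_i` is preimage under the map that sends `i - 1, i, i + 1` to `i - 1` and shifts later
positions by two. This turns the counts for `t i B` into those for `B`. -/
lemma mem_xi_iff {i j : ℕ} {I : ℕ × ℕ} (h1 : 1 ≤ I.1) (hi : 1 ≤ i) :
    j ∈ Finset.Icc (xi i I).1 (xi i I).2 ↔ (ins i (i - 1) id j) ∈ Finset.Icc I.1 I.2 := by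
  unfold xi ins
  simp only [Finset.mem_Icc, id]
  split_ifs <;> dsimp only <;> omega

lemma xi_parity (i h : ℕ) {I : ℕ × ℕ} (h2 : I.1 ≤ I.2) :
    (xi i I).2 + 1 - (xi i I).1 ≡ h [MOD 2] ↔ I.2 + 1 - I.1 ≡ h [MOD 2] := by
  unfold xi Nat.ModEq
  split_ifs <;> dsimp only <;> omega

lemma card_part_zero_t {i : ℕ} {B : Finset (ℕ × ℕ)} (hB : ∀ I ∈ B, 1 ≤ I.1 ∧ I.1 ≤ I.2) :
    (part (t i B) 0).card = (part B 0).card := by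
  unfold part t
  rw [Finset.filter_insert, if_neg (by simp [Nat.ModEq]), Finset.filter_image,
    Finset.card_image_of_injective _ (xi_injective i)]
  congr 1
  exact Finset.filter_congr fun I hI => xi_parity i 0 (hB I hI).2

lemma card_partAt_zero_t {i j : ℕ} (hi : 1 ≤ i) {B : Finset (ℕ × ℕ)}
    (hB : ∀ I ∈ B, 1 ≤ I.1 ∧ I.1 ≤ I.2) :
    (partAt (t i B) 0 j).card = (partAt B 0 (ins i (i - 1) id j)).card := by
  unfold partAt part t
  rw [Finset.filter_filter, Finset.filter_filter, Finset.filter_insert,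
    if_neg (by simp [Nat.ModEq]), Finset.filter_image,
    Finset.card_image_of_injective _ (xi_injective i)]
  congr 1
  exact Finset.filter_congr fun I hI =>
    and_congr (xi_parity i 0 (hB I hI).2) (mem_xi_iff (hB I hI).1 hi)

lemma card_partAt_one_t {i j : ℕ} (hi : 1 ≤ i) {B : Finset (ℕ × ℕ)}
    (hB : ∀ I ∈ B, 1 ≤ I.1 ∧ I.1 ≤ I.2) :
    (partAt (t i B) 1 j).card =
      (partAt B 1 (ins i (i - 1) id j)).card + if j = i then 1 else 0 := by
  have key : ((B.image (xi i)).filter fun I : ℕ × ℕ => I.2 + 1 - I.1 ≡ 1 [MOD 2] ∧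
      j ∈ Finset.Icc I.1 I.2).card = (partAt B 1 (ins i (i - 1) id j)).card := by
    unfold partAt part
    rw [Finset.filter_filter, Finset.filter_image,
      Finset.card_image_of_injective _ (xi_injective i)]
    congr 1
    exact Finset.filter_congr fun I hI =>
      and_congr (xi_parity i 1 (hB I hI).2) (mem_xi_iff (hB I hI).1 hi)
  rw [← key]
  unfold partAt part t
  rw [Finset.filter_filter, Finset.filter_insert]
  by_cases h : j = i
  · subst h
    rw [if_pos (by simp [Nat.ModEq]), if_pos rfl, Finset.card_insert_of_notMem]
    exact fun h => singleton_notMem_image_xi j B (Finset.mem_filter.1 h).1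
  · rw [if_neg (by simp only [Finset.mem_Icc]; omega), if_neg h, add_zero]

lemma f_t {i : ℕ} (hi : 1 ≤ i) {B : Finset (ℕ × ℕ)} (hB : ∀ I ∈ B, 1 ≤ I.1 ∧ I.1 ≤ I.2) :
    f (t i B) = ins i (f B (i - 1) + 1) (f B) := by
  funext j
  unfold f
  rw [card_part_zero_t hB, card_partAt_zero_t hi hB, card_partAt_one_t hi hB]
  rcases lt_trichotomy j i with h | h | h
  · simp [ins, h, h.ne]
  · simp [ins, h]; ring
  · simp [ins, h.ne', h.not_gt]

lemma card_part_zero_prim {D k : ℕ} (hD : Even D) :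
    (part (prim D k) 0).card = k := by
  rw [Nat.even_iff] at hD
  unfold part prim
  rw [Finset.filter_true_of_mem, Finset.card_image_of_injective, Nat.card_Icc]
  · omega
  · intro a b h; simpa using (Prod.ext_iff.1 h).1
  · intro I hI
    rw [Finset.mem_image] at hI
    obtain ⟨a, ha, rfl⟩ := hI
    rw [Finset.mem_Icc] at ha
    unfold Nat.ModEq
    dsimp only
    omega

lemma f_prim {D k j : ℕ} (hD : Even D) (hk : k ≤ D / 2) (hj : j ≤ D + 1) :
    f (prim D k) j = profile D k j := by
  have hD' := Nat.even_iff.1 hD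
  have h1 : (partAt (prim D k) 1 j).card = 0 := by
    rw [Finset.card_eq_zero]
    unfold partAt part prim
    rw [Finset.filter_filter]
    refine Finset.filter_false_of_mem fun I hI => ?_
    rw [Finset.mem_image] at hI
    obtain ⟨a, ha, rfl⟩ := hI
    rw [Finset.mem_Icc] at ha
    unfold Nat.ModEq
    dsimp only
    omega
  have h0 : (partAt (prim D k) 0 j).card = min k (min j (D + 1 - j)) := by
    unfold partAt part prim
    rw [Finset.filter_filter, Finset.filter_image, Finset.card_image_of_injective]
    · have : (Finset.Icc 1 k).filter (fun a => (D + 1 - a + 1 - a ≡ 0 [MOD 2]) ∧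
          j ∈ Finset.Icc a (D + 1 - a)) = Finset.Icc 1 (min k (min j (D + 1 - j))) := by
        ext a
        simp only [Finset.mem_filter, Finset.mem_Icc, Nat.ModEq]
        omega
      rw [this, Nat.card_Icc]
      omega
    · intro a b h; simpa using (Prod.ext_iff.1 h).1
  unfold f profile
  rw [h1, h0, card_part_zero_prim hD]
  push_cast
  ring

/-! ### Collections correspond to walks -/

lemma Walk.congr {D K : ℕ} {g g' : ℕ → ℤ} (h : Walk D K g) (e : ∀ j ≤ D + 1, g' j = g j) :
    Walk D K g' where
  start := by rw [e _ (by omega), h.start]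
  final := by rw [e _ (by omega), h.final]
  step j hj := by rw [e _ (by omega), e _ (by omega)]; exact h.step j hj

lemma IsS.bounds' {D : ℕ} {B : Finset (ℕ × ℕ)} (h : IsS D B) :
    ∀ I ∈ B, 1 ≤ I.1 ∧ I.1 ≤ I.2 := fun I hI => ⟨(h.bounds I hI).1, (h.bounds I hI).2.1⟩

lemma IsS.walk {D : ℕ} {B : Finset (ℕ × ℕ)} (h : IsS D B) :
    Walk D (part B 0).card (f B) := by
  induction h with
  | primitive D k hD hk =>
    rw [card_part_zero_prim hD]
    exact (walk_profile hk).congr fun j hj => f_prim hD hk hj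
  | step D i B hB hi ih =>
    rw [Finset.mem_Icc] at hi
    rw [card_part_zero_t hB.bounds', f_t hi.1 hB.bounds']
    refine ih.ins hi.1 hi.2 ?_
    have := ih.floor_le (show i - 1 ≤ D + 1 by omega)
    unfold Step
    omega

/-- Every walk comes from a collection in `𝐒_D`. -/
lemma Walk.exists_isS {D K : ℕ} {g : ℕ → ℤ} (hD : Even D) (h : Walk D K g) :
    ∃ B, IsS D B ∧ (part B 0).card = K ∧ ∀ j ≤ D + 1, f B j = g j := by
  induction D using Nat.strong_induction_on generalizing g with
  | _ D ih =>
    by_cases hp : ∀ i, 1 ≤ i → i ≤ D → g i = g (i - 1) + 1 → g (i + 1) ≠ g (i - 1)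
    · have hK := h.le_half hD
      refine ⟨prim D K, .primitive D K hD hK, card_part_zero_prim hD, fun j hj => ?_⟩
      rw [f_prim hD hK hj, h.eq_profile hp j hj]
    · push Not at hp
      obtain ⟨i, hi, hi', e, e'⟩ := hp
      obtain ⟨D, rfl⟩ : ∃ D', D = D' + 2 := ⟨D - 2, by rw [Nat.even_iff] at hD; omega⟩
      obtain ⟨B, hB, hK, hf⟩ := ih D (by omega) (by simpa [Nat.even_add] using hD)
        (h.del hi hi' e'.symm)
      refine ⟨t i B, .step D i B hB (Finset.mem_Icc.2 ⟨hi, hi'⟩), ?_, fun j hj => ?_⟩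
      · rw [card_part_zero_t hB.bounds', hK]
      · rw [f_t hi hB.bounds']
        conv_rhs => rw [← ins_del hi e'.symm]
        unfold NewBasis.ins
        split_ifs with h1 h2
        · exact hf j (by omega)
        · rw [hf _ (by omega), e, NewBasis.del, if_pos (by omega)]
        · exact hf _ (by omega)

/-- Valleys have no peaks, so `B` ends with some `t j`. Peaks at adjacent positions are impossible;
if `i ≠ j`, the peak at `i` already exists before that insertion, and `t_comm` moves it last. -/
lemma IsS.exists_eq_t {D : ℕ} {B : Finset (ℕ × ℕ)} (h : IsS D B) {i : ℕ} (hi : 1 ≤ i)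
    (hi' : i ≤ D) (e : f B i = f B (i - 1) + 1) (e' : f B (i + 1) = f B (i - 1)) :
    ∃ D' B', D = D' + 2 ∧ IsS D' B' ∧ B = t i B' := by
  induction h generalizing i with
  | primitive D k hD hk =>
    exfalso
    rw [f_prim hD hk (by omega), f_prim hD hk (by omega)] at e e'
    unfold profile at e e'
    omega
  | step D j B hB hj ih =>
    rw [Finset.mem_Icc] at hj
    rw [f_t hj.1 hB.bounds'] at e e'
    unfold ins at e e'
    obtain h1 | rfl | rfl | rfl | h1 :
      i + 2 ≤ j ∨ i + 1 = j ∨ i = j ∨ i = j + 1 ∨ j + 2 ≤ i := by omega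
    · simp only [show i < j by omega, show i - 1 < j by omega, show i + 1 < j by omega,
        if_true] at e e'
      obtain ⟨D', B', rfl, hB', rfl⟩ := ih hi (by omega) e e'
      refine ⟨D' + 2, t (j - 2) B', rfl, .step D' _ B' hB' (by rw [Finset.mem_Icc]; omega), ?_⟩
      rw [t_comm (show i ≤ j - 2 by omega), Nat.sub_add_cancel (by omega)]
    · simp [show i - 1 < i + 1 by omega] at e e'
      omega
    · exact ⟨D, B, rfl, hB, rfl⟩
    · simp at e e'
      omega
    · obtain ⟨i, rfl⟩ := Nat.exists_eq_add_of_le' (show 2 ≤ i by omega)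
      rw [if_neg (by omega), if_neg (by omega), if_neg (by omega), if_neg (by omega)] at e e'
      obtain ⟨D', B', rfl, hB', rfl⟩ := ih (show 1 ≤ i by omega) (by omega)
        (by rw [show i - 1 = i + 2 - 1 - 2 by omega]; exact e)
        (by rw [show i - 1 = i + 2 - 1 - 2 by omega]; exact e')
      refine ⟨D' + 2, t j B', rfl, .step D' _ B' hB' (by rw [Finset.mem_Icc]; omega), ?_⟩
      rw [t_comm (show j ≤ i by omega)]

lemma IsS.eq_prim {D : ℕ} {B : Finset (ℕ × ℕ)} (h : IsS D B)
    (hp : ∀ i, 1 ≤ i → i ≤ D → f B i = f B (i - 1) + 1 → f B (i + 1) ≠ f B (i - 1)) :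
    B = prim D (part B 0).card := by
  cases h with
  | primitive D k hD hk => rw [card_part_zero_prim hD]
  | step D i B hB hi =>
    rw [Finset.mem_Icc] at hi
    have h1 := hp i hi.1 hi.2
    rw [f_t hi.1 hB.bounds'] at h1
    simp [ins, show i - 1 < i by omega] at h1

/-- A collection in `𝐒_D` is determined by its number of even intervals and its sequence `f`. -/
lemma IsS.unique {D : ℕ} {B B' : Finset (ℕ × ℕ)} (h : IsS D B) (h' : IsS D B')
    (hK : (part B 0).card = (part B' 0).card) (e : ∀ j ≤ D + 1, f B j = f B' j) : B = B' := by
  induction D using Nat.strong_induction_on generalizing B B' with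
  | _ D ih =>
    by_cases hp : ∀ i, 1 ≤ i → i ≤ D → f B i = f B (i - 1) + 1 → f B (i + 1) ≠ f B (i - 1)
    · rw [h.eq_prim hp, h'.eq_prim, hK]
      intro i hi hi'
      rw [← e _ (by omega), ← e _ (by omega), ← e _ (by omega)]
      exact hp i hi hi'
    · push Not at hp
      obtain ⟨i, hi, hi', e1, e2⟩ := hp
      obtain ⟨D, C, rfl, hC, rfl⟩ := h.exists_eq_t hi hi' e1 e2
      rw [e _ (by omega), e _ (by omega)] at e1 e2
      obtain ⟨D'', C', hD, hC', rfl⟩ := h'.exists_eq_t hi hi' e1 e2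
      obtain rfl : D'' = D := by omega
      rw [card_part_zero_t hC.bounds', card_part_zero_t hC'.bounds'] at hK
      rw [ih D'' (by omega) hC hC' hK]
      rw [f_t hi hC.bounds', f_t hi hC'.bounds'] at e
      intro j hj
      by_cases hji : j < i
      · simpa [ins, hji] using e j (by omega)
      · simpa [ins, show ¬ j + 2 < i by omega, show j + 2 ≠ i by omega] using e (j + 2) (by omega)


/-! ### Spans and contraction -/

/-- The coordinates of `x`, extended by zero to all natural numbers. -/
def ext (D : ℕ) : V D →ₗ[ZMod 2] (ℕ → ZMod 2) where
  toFun x j := if h : j ∈ Finset.Icc 1 D then x ⟨j, h⟩ else 0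
  map_add' x y := by
    funext j
    rw [Pi.add_apply]
    split_ifs
    · rfl
    · exact (add_zero 0).symm
  map_smul' a x := by
    funext j
    rw [RingHom.id_apply, Pi.smul_apply]
    split_ifs
    · rfl
    · exact (smul_zero a).symm

lemma ext_apply {D : ℕ} (x : V D) (j : {i : ℕ // i ∈ Finset.Icc 1 D}) : ext D x j = x j :=
  dif_pos j.2

lemma ext_of_notMem {D : ℕ} (x : V D) {j : ℕ} (h : j ∉ Finset.Icc 1 D) : ext D x j = 0 :=
  dif_neg h

lemma eI_apply (D : ℕ) (I : ℕ × ℕ) (j : {i : ℕ // i ∈ Finset.Icc 1 D}) :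
    eI D I j = if (j : ℕ) ∈ Finset.Icc I.1 I.2 then 1 else 0 := by
  unfold eI
  rw [Finset.sum_apply, Finset.sum_eq_single j]
  · split_ifs <;> simp
  · intro i _ hi
    split_ifs
    · simp [hi.symm]
    · rfl
  · simp

lemma ext_eI (D : ℕ) (I : ℕ × ℕ) (j : ℕ) :
    ext D (eI D I) j = if j ∈ Finset.Icc 1 D ∧ j ∈ Finset.Icc I.1 I.2 then 1 else 0 := by
  by_cases h : j ∈ Finset.Icc 1 D
  · rw [ext_apply (eI D I) ⟨j, h⟩, eI_apply]
    simp only [h, true_and]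
  · rw [ext_of_notMem _ h, if_neg (fun h' => h h'.1)]

/-- The span of the vectors `e_I`, `I ∈ B`. -/
def spanOf (D : ℕ) (B : Finset (ℕ × ℕ)) : Submodule (ZMod 2) (V D) :=
  Submodule.span (ZMod 2) (eI D '' (B : Set (ℕ × ℕ)))

/-- The linear map `V_{D+2} → V_D` removing the coordinates `i` and `i + 1`. -/
def contract (D i : ℕ) : V (D + 2) →ₗ[ZMod 2] V D where
  toFun x j := del i (ext (D + 2) x) j
  map_add' x y := by
    funext j
    simp only [map_add, del, Pi.add_apply]
    split_ifs <;> rfl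
  map_smul' a x := by
    funext j
    simp only [map_smul, del, Pi.smul_apply, RingHom.id_apply]
    split_ifs <;> rfl

lemma contract_apply (D i : ℕ) (x : V (D + 2)) (j : {i : ℕ // i ∈ Finset.Icc 1 D}) :
    contract D i x j = del i (ext (D + 2) x) j := rfl

lemma ext_contract {D i : ℕ} (hi : 1 ≤ i) (hi' : i ≤ D + 2) (x : V (D + 2))
    (e : ext (D + 2) x (i - 1) = ext (D + 2) x (i + 1)) {j : ℕ} (hj : j ≤ D + 1) :
    ext D (contract D i x) j = del i (ext (D + 2) x) j := by
  by_cases h : j ∈ Finset.Icc 1 D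
  · rw [ext_apply (contract D i x) ⟨j, h⟩, contract_apply]
  · rw [ext_of_notMem _ h]
    rw [Finset.mem_Icc] at h
    unfold del
    split_ifs with h1
    · rcases Nat.eq_zero_or_pos j with rfl | h2
      · rw [ext_of_notMem _ (by simp)]
      -- Only here is `e` needed: for `i = D + 2` the last coordinate of `x` is not deleted and
      -- becomes the right boundary value.
      · obtain rfl : i = D + 2 := by omega
        obtain rfl : j = D + 2 - 1 := by omega
        rw [e, ext_of_notMem _ (by simp)]
    · rw [ext_of_notMem _ (by rw [Finset.mem_Icc]; omega)]

lemma contract_eI_xi {D i : ℕ} (hi : 1 ≤ i) {I : ℕ × ℕ} (h1 : 1 ≤ I.1) :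
    contract D i (eI (D + 2) (xi i I)) = eI D I := by
  funext j
  rw [contract_apply, eI_apply]
  obtain ⟨j, hj⟩ := j
  rw [Finset.mem_Icc] at hj
  unfold del
  dsimp only
  have key : ∀ m, 1 ≤ m → m ≤ D + 2 → ext (D + 2) (eI (D + 2) (xi i I)) m =
      if ins i (i - 1) id m ∈ Finset.Icc I.1 I.2 then 1 else 0 := by
    intro m hm hm'
    rw [ext_eI]
    refine if_congr ?_ rfl rfl
    rw [mem_xi_iff h1 hi, and_iff_right (Finset.mem_Icc.2 ⟨hm, hm'⟩)]
  split_ifs with h h' h'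
  · rw [key j (by omega) (by omega), if_pos]; simpa [ins, h] using h'
  · rw [key j (by omega) (by omega), if_neg]; simpa [ins, h] using h'
  · rw [key _ (by omega) (by omega), if_pos]
    simpa [ins, show ¬ j + 2 < i by omega, show j + 2 ≠ i by omega] using h'
  · rw [key _ (by omega) (by omega), if_neg]
    simpa [ins, show ¬ j + 2 < i by omega, show j + 2 ≠ i by omega] using h'

lemma contract_eI_singleton {D i : ℕ} : contract D i (eI (D + 2) (i, i)) = 0 := by
  funext j
  rw [contract_apply]
  unfold del
  split_ifs with h
  · rw [ext_eI, if_neg]; · rfl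
    simp only [Finset.mem_Icc]; omega
  · rw [ext_eI, if_neg]; · rfl
    simp only [Finset.mem_Icc]; omega

lemma map_contract_spanOf {D i : ℕ} (hi : 1 ≤ i) {B : Finset (ℕ × ℕ)}
    (hB : ∀ I ∈ B, 1 ≤ I.1 ∧ I.1 ≤ I.2) :
    (spanOf (D + 2) (t i B)).map (contract D i) = spanOf D B := by
  unfold spanOf
  rw [Submodule.map_span, t, Finset.coe_insert, Set.image_insert_eq, Set.image_insert_eq,
    contract_eI_singleton, Submodule.span_insert_zero, Finset.coe_image, Set.image_image,
    Set.image_image]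
  congr 1
  exact Set.image_congr fun I hI => contract_eI_xi hi (hB I hI).1

lemma ext_eq_of_mem_spanOf_t {D i : ℕ} (hi : 1 ≤ i) (hi' : i ≤ D + 2) {B : Finset (ℕ × ℕ)}
    (hB : ∀ I ∈ B, 1 ≤ I.1 ∧ I.1 ≤ I.2 ∧ I.2 ≤ D) {x : V (D + 2)}
    (hx : x ∈ spanOf (D + 2) (t i B)) : ext (D + 2) x (i - 1) = ext (D + 2) x (i + 1) := by
  unfold spanOf at hx
  induction hx using Submodule.span_induction with
  | zero => simp
  | add x y _ _ h h' => simp [h, h']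
  | smul a x _ h => simp [h]
  | mem x hx =>
    obtain ⟨I, hI, rfl⟩ := hx
    rw [ext_eI, ext_eI]
    congr 1
    rw [eq_iff_iff]
    rw [Finset.mem_coe, t, Finset.mem_insert, Finset.mem_image] at hI
    rcases hI with rfl | ⟨J, hJ, rfl⟩
    · simp only [Finset.mem_Icc]; omega
    · have := hB J hJ
      unfold xi
      split_ifs <;> simp only [Finset.mem_Icc] <;> omega

lemma mem_spanOf_t {D i : ℕ} (hi : 1 ≤ i) (hi' : i ≤ D + 2) {B : Finset (ℕ × ℕ)}
    (hB : ∀ I ∈ B, 1 ≤ I.1 ∧ I.1 ≤ I.2 ∧ I.2 ≤ D) {x : V (D + 2)}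
    (e : ext (D + 2) x (i - 1) = ext (D + 2) x (i + 1)) (hx : contract D i x ∈ spanOf D B) :
    x ∈ spanOf (D + 2) (t i B) := by
  rw [← map_contract_spanOf hi fun I hI => ⟨(hB I hI).1, (hB I hI).2.1⟩] at hx
  obtain ⟨z, hz, hzx⟩ := hx
  have ez := ext_eq_of_mem_spanOf_t hi hi' hB hz
  have hi2 : i ∈ Finset.Icc 1 (D + 2) := Finset.mem_Icc.2 ⟨hi, hi'⟩
  -- Equal contractions together with `e` and `ez` leave only coordinate `i` free, and `[i, i]`
  -- belongs to `t i B`.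
  have hsub : x - z = (x ⟨i, hi2⟩ - z ⟨i, hi2⟩) • eI (D + 2) (i, i) := by
    have hdel : ∀ j ≤ D + 1, del i (ext (D + 2) x) j = del i (ext (D + 2) z) j := fun j hj => by
      rw [← ext_contract hi hi' x e hj, ← ext_contract hi hi' z ez hj, hzx]
    funext ⟨j, hj⟩
    rw [Pi.sub_apply, Pi.smul_apply, eI_apply]
    rw [← ext_apply x ⟨j, hj⟩, ← ext_apply z ⟨j, hj⟩]
    have hj' := Finset.mem_Icc.1 hj
    dsimp only
    rcases lt_trichotomy j i with h | rfl | h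
    · have := hdel j (by omega)
      simp only [del, h, if_true] at this
      rw [this, if_neg (by rw [Finset.mem_Icc]; omega)]; simp
    · rw [← ext_apply x ⟨j, hj⟩, ← ext_apply z ⟨j, hj⟩, if_pos (by simp)]; simp
    · rw [if_neg (by rw [Finset.mem_Icc]; omega), smul_zero, sub_eq_zero]
      rcases (show j = i + 1 ∨ i + 2 ≤ j by omega) with rfl | h
      · have := hdel (i - 1) (by omega)
        simp only [del, show i - 1 < i by omega, if_true] at this
        rw [← e, ← ez, this]
      · have := hdel (j - 2) (by omega)
        rwa [del, del, if_neg (by omega), if_neg (by omega), Nat.sub_add_cancel (by omega)] at this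
  rw [← sub_add_cancel x z, hsub]
  refine Submodule.add_mem _ (Submodule.smul_mem _ _ (Submodule.subset_span ⟨(i, i), ?_, rfl⟩)) hz
  simp [t]

lemma ext_of_mem_spanOf_prim {D k : ℕ} {x : V D} (hx : x ∈ spanOf D (prim D k)) :
    (∀ j ≤ D + 1, ext D x (D + 1 - j) = ext D x j) ∧
      ∀ j, k ≤ j → j ≤ D + 1 - k → ext D x j = ext D x k := by
  unfold spanOf at hx
  induction hx using Submodule.span_induction with
  | zero => simp
  | add x y _ _ h h' =>
    simp only [map_add, Pi.add_apply]
    exact ⟨fun j hj => by rw [h.1 j hj, h'.1 j hj], fun j hj hj' => by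
      rw [h.2 j hj hj', h'.2 j hj hj']⟩
  | smul a x _ h =>
    simp only [map_smul, Pi.smul_apply]
    exact ⟨fun j hj => by rw [h.1 j hj], fun j hj hj' => by rw [h.2 j hj hj']⟩
  | mem x hx =>
    obtain ⟨I, hI, rfl⟩ := hx
    simp only [prim, Finset.coe_image, Set.mem_image, Finset.mem_coe, Finset.mem_Icc] at hI
    obtain ⟨a, ha, rfl⟩ := hI
    simp only [ext_eI]
    refine ⟨fun j hj => ?_, fun j hj hj' => ?_⟩ <;> congr 1 <;>
      simp only [eq_iff_iff, Finset.mem_Icc] <;> omega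

/-- The coefficient of `[a, D + 1 - a]` is the increment `x_a - x_{a-1}`; the sum telescopes. -/
lemma mem_spanOf_prim {D k : ℕ} (hk : k ≤ D / 2) {x : V D}
    (hs : ∀ j ≤ D + 1, ext D x (D + 1 - j) = ext D x j)
    (hc : ∀ j, k ≤ j → j ≤ D + 1 - k → ext D x j = ext D x k) : x ∈ spanOf D (prim D k) := by
  have h0 : ext D x 0 = 0 := ext_of_notMem _ (by simp)
  have key : x = ∑ a ∈ Finset.Icc 1 k, (ext D x a - ext D x (a - 1)) • eI D (a, D + 1 - a) := by
    have tele : ∀ n, ∑ a ∈ Finset.Icc 1 n, (ext D x a - ext D x (a - 1)) = ext D x n := by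
      intro n
      induction n with
      | zero => simp [h0]
      | succ n ih => rw [Finset.sum_Icc_succ_top (by omega), ih]; simp
    funext ⟨j, hj⟩
    have hj' := Finset.mem_Icc.1 hj
    simp only [Finset.sum_apply, Pi.smul_apply, eI_apply, smul_eq_mul, mul_ite, mul_one, mul_zero]
    rw [← Finset.sum_filter]
    have : (Finset.Icc 1 k).filter (fun a => j ∈ Finset.Icc a (D + 1 - a)) =
        Finset.Icc 1 (min k (min j (D + 1 - j))) := by
      ext a
      simp only [Finset.mem_filter, Finset.mem_Icc]
      omega
    rw [this, tele, ← ext_apply x ⟨j, hj⟩]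
    dsimp only
    rcases (show j ≤ k ∨ D + 1 - j ≤ k ∨ (k ≤ j ∧ j ≤ D + 1 - k) by omega) with h | h | h
    · exact congrArg (ext D x) (by omega)
    · rw [← hs j (by omega)]; exact congrArg (ext D x) (by omega)
    · rw [hc j h.1 h.2]; exact congrArg (ext D x) (by omega)
  rw [key]
  refine Submodule.sum_mem _ fun a ha => Submodule.smul_mem _ _ (Submodule.subset_span ⟨_, ?_, rfl⟩)
  exact Finset.mem_coe.2 (Finset.mem_image.2 ⟨a, ha, rfl⟩)

/-! ### Triangularity -/

lemma IsS.mem_spanOf {D : ℕ} {B : Finset (ℕ × ℕ)} (h : IsS D B) {x : V D}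
    (hx : ∀ j ≤ D + 1, ext D x j = tri (f B j)) : x ∈ spanOf D B := by
  induction h with
  | primitive D k hD hk =>
    refine mem_spanOf_prim hk (fun j hj => ?_) fun j hj hj' => ?_
    · rw [hx _ (by omega), hx _ hj, f_prim hD hk (by omega), f_prim hD hk hj]
      congr 1; unfold profile; omega
    · rw [hx _ (by omega), hx _ (by omega), f_prim hD hk (by omega), f_prim hD hk (by omega)]
      congr 1; unfold profile; omega
  | step D i B hB hi ih =>
    rw [Finset.mem_Icc] at hi
    rw [f_t hi.1 hB.bounds'] at hx
    have e : ext (D + 2) x (i - 1) = ext (D + 2) x (i + 1) := by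
      rw [hx _ (by omega), hx _ (by omega)]
      simp [ins, show i - 1 < i by omega]
    refine mem_spanOf_t hi.1 hi.2 hB.bounds e (ih fun j hj => ?_)
    rw [ext_contract hi.1 hi.2 x e hj, del]
    split_ifs with h
    · rw [hx _ (by omega)]; simp [ins, h]
    · rw [hx _ (by omega)]; simp [ins, show ¬ j + 2 < i by omega, show j + 2 ≠ i by omega]

/-- The vector is symmetric and constant on `[k, D + 1 - k]`. This forces the walk to be symmetric
and to rest at its floor from `k` on; reaching the floor in `k` steps gives `K ≤ k`. -/
lemma Walk.le_of_mem_spanOf_prim {D K k : ℕ} (hD : Even D) (hk : k ≤ D / 2) {g : ℕ → ℤ}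
    (hg : Walk D K g) {x : V D} (hx : x ∈ spanOf D (prim D k))
    (e : ∀ j ≤ D + 1, tri (g j) = ext D x j) :
    K < k ∨ K = k ∧ ∀ j ≤ D + 1, g j ≤ profile D k j := by
  obtain ⟨hs, hc⟩ := ext_of_mem_spanOf_prim hx
  have hD' := Nat.even_iff.1 hD
  have symm : ∀ j ≤ D + 1, g (D + 1 - j) = g j := by
    intro j
    induction j with
    | zero => intro _; rw [Nat.sub_zero, hg.final, hg.start]
    | succ j ih =>
      intro hj
      have h1 := hg.step j (by omega)
      have h2 := hg.step (D + 1 - (j + 1)) (by omega)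
      rw [show D + 1 - (j + 1) + 1 = D + 1 - j by omega, ih (by omega)] at h2
      refine h2.symm.unique (even_floor K) h1 ?_
      rw [e _ (by omega), e _ (by omega), hs _ hj]
  have alt : ∀ m, k + 2 * m + 1 ≤ D + 1 - k →
      g (k + 2 * m) = g k ∧ g (k + 2 * m + 1) = g (k + 1) := by
    intro m
    induction m with
    | zero => simp
    | succ m ih =>
      intro hm
      obtain ⟨h1, h2⟩ := ih (by omega)
      have e1 := hg.eq_of_tri_eq (i := k + 2 * m + 1) (by omega) (by omega)
        (by rw [e _ (by omega), e _ (by omega), hc _ (by omega) (by omega),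
          hc (k + 2 * m + 1 + 1) (by omega) (by omega)])
      have e2 := hg.eq_of_tri_eq (i := k + 2 * m + 2) (by omega) (by omega)
        (by rw [e _ (by omega), e _ (by omega), hc _ (by omega) (by omega),
          hc (k + 2 * m + 2 + 1) (by omega) (by omega)])
      exact ⟨e1.symm.trans h1, e2.symm.trans h2⟩
  -- The positions `k` and `D + 1 - k` have opposite parities, so alternation and symmetry identify
  -- the two alternating values.
  have flat : g (k + 1) = g k := by
    have := (alt ((D - 2 * k) / 2) (by omega)).2
    rw [show k + 2 * ((D - 2 * k) / 2) + 1 = D + 1 - k by omega, symm k (by omega)] at this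
    exact this.symm
  have hfl : g k = floor K := by
    have := hg.step k (by omega)
    unfold Step at this
    omega
  have h0 := hg.abs_sub_le 0 k (by omega)
  rw [zero_add, hg.start, hfl] at h0
  rcases lt_or_ge K k with h | h
  · exact Or.inl h
  have hKk : K = k := by
    unfold floor at h0; omega
  refine Or.inr ⟨hKk, ?_⟩
  have left : ∀ j ≤ k, g j ≤ profile D k j := by
    intro j hj
    have := (hg.abs_sub_le j (k - j) (by omega)).2
    rw [Nat.add_sub_cancel' hj, hfl] at this
    unfold profile
    unfold floor at this
    omega
  intro j hj
  rcases (show j ≤ k ∨ D + 1 - j ≤ k ∨ (k ≤ j ∧ j ≤ D + 1 - k) by omega) with h | h | h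
  · exact left j h
  · have := left _ h
    rw [symm j hj] at this
    refine this.trans (le_of_eq ?_)
    unfold profile
    omega
  · have : g j = g k := by
      rcases Nat.even_or_odd' (j - k) with ⟨m, hm | hm⟩
      · by_cases h' : k + 2 * m + 1 ≤ D + 1 - k
        · rw [← (alt m h').1]; congr 1; omega
        · rw [← symm k (by omega)]; congr 1; omega
      · rw [← flat, ← (alt m (by omega)).2]; congr 1; omega
    rw [this, hfl]
    unfold profile floor
    omega

/-- Triangularity: a point of `⟨B⟩` is attached to a walk not above that of `B`. -/
lemma IsS.walk_le {D : ℕ} {B : Finset (ℕ × ℕ)} (h : IsS D B) {K : ℕ} {g : ℕ → ℤ}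
    (hg : Walk D K g) {x : V D} (hx : x ∈ spanOf D B) (e : ∀ j ≤ D + 1, tri (g j) = ext D x j) :
    K < (part B 0).card ∨ K = (part B 0).card ∧ ∀ j ≤ D + 1, g j ≤ f B j := by
  induction h generalizing g with
  | primitive D k hD hk =>
    rw [card_part_zero_prim hD]
    refine (hg.le_of_mem_spanOf_prim hD hk hx e).imp_right fun h => ⟨h.1, fun j hj => ?_⟩
    rw [f_prim hD hk hj]
    exact h.2 j hj
  | step D i B hB hi ih =>
    rw [Finset.mem_Icc] at hi
    have ex := ext_eq_of_mem_spanOf_t hi.1 hi.2 hB.bounds hx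
    have eg := hg.eq_of_tri_eq hi.1 hi.2 (by rw [e _ (by omega), e _ (by omega), ex])
    have hx' : contract D i x ∈ spanOf D B := by
      rw [← map_contract_spanOf hi.1 hB.bounds']
      exact Submodule.mem_map_of_mem hx
    rw [card_part_zero_t hB.bounds', f_t hi.1 hB.bounds']
    refine (ih (hg.del hi.1 hi.2 eg) hx' fun j hj => ?_).imp_right fun h => ⟨h.1, fun j hj => ?_⟩
    · rw [ext_contract hi.1 hi.2 x ex hj]
      unfold NewBasis.del
      split_ifs
      · exact e _ (by omega)
      · exact e _ (by omega)
    · conv_lhs => rw [← ins_del hi.1 eg]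
      unfold NewBasis.ins
      split_ifs with h1 h2
      · exact h.2 j (by omega)
      -- At `i` the collection has a peak, the highest value one step can reach: `g i ≤ g (i - 1) +
      -- 1 ≤ f B (i - 1) + 1`.
      · have h3 := h.2 (i - 1) (by omega)
        rw [NewBasis.del, if_pos (by omega)] at h3
        have h4 := hg.step (i - 1) (by omega)
        rw [Nat.sub_add_cancel hi.1] at h4
        unfold Step at h4
        omega
      · exact h.2 _ (by omega)

/-! ### The bijection and the order -/

lemma ext_eps {D : ℕ} (B : S D) {j : ℕ} (hj : j ≤ D + 1) : ext D (eps B) j = tri (f B.1 j) := by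
  by_cases h : j ∈ Finset.Icc 1 D
  · exact ext_apply (eps B) ⟨j, h⟩
  · rw [ext_of_notMem _ h]
    rw [Finset.mem_Icc] at h
    rcases (show j = 0 ∨ j = D + 1 by omega) with rfl | rfl
    · rw [B.2.walk.start, tri_neg_parity]
    · rw [B.2.walk.final, tri_neg_parity]

lemma eps_injective {D : ℕ} : Function.Injective (eps (D := D)) := by
  intro B B' h
  have e : ∀ j ≤ D + 1, tri (f B.1 j) = tri (f B'.1 j) := fun j hj => by
    rw [← ext_eps B hj, ← ext_eps B' hj, h]
  have hK := B.2.walk.index_unique B.2.even B'.2.walk e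
  have hw := B.2.walk
  rw [hK] at hw
  exact Subtype.ext (B.2.unique B'.2 hK (hw.unique B'.2.walk e))

lemma eps_surjective {D : ℕ} (hD : Even D) : Function.Surjective (eps (D := D)) := by
  intro x
  obtain ⟨K, g, hg, e⟩ := exists_walk hD (ext D x) (ext_of_notMem _ (by simp))
    (ext_of_notMem _ (by simp))
  obtain ⟨B, hB, -, hf⟩ := hg.exists_isS hD
  refine ⟨⟨B, hB⟩, ?_⟩
  funext j
  have hj := Finset.mem_Icc.1 j.2
  rw [← ext_apply (eps _) j, ext_eps _ (by omega), hf _ (by omega), e _ (by omega), ext_apply]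

lemma eps_mem_spanB {D : ℕ} (B : S D) : eps B ∈ spanB B :=
  B.2.mem_spanOf fun _ hj => ext_eps B hj

lemma leS_of_eps_mem {D : ℕ} {B B' : S D} (h : eps B' ∈ spanB B) : leS B' B := by
  refine (B.2.walk_le B'.2.walk h fun j hj => (ext_eps B' hj).symm).imp_right fun h' =>
    ⟨h'.1, fun i hi => h'.2 i ?_⟩
  rw [Finset.mem_Icc] at hi
  omega

lemma leS_refl {D : ℕ} (B : S D) : leS B B := Or.inr ⟨rfl, fun _ _ => le_rfl⟩

lemma leS_trans {D : ℕ} {B B' B'' : S D} (h : leS B B') (h' : leS B' B'') : leS B B'' := by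
  rcases h with h | ⟨h1, h2⟩ <;> rcases h' with h' | ⟨h1', h2'⟩
  · exact Or.inl (h.trans h')
  · exact Or.inl (h1' ▸ h)
  · exact Or.inl (h1 ▸ h')
  · exact Or.inr ⟨h1.trans h1', fun i hi => (h2 i hi).trans (h2' i hi)⟩

lemma leS_antisymm {D : ℕ} {B B' : S D} (h : leS B B') (h' : leS B' B) : B = B' := by
  have hf : ∀ i ∈ Finset.Icc 1 D, f B.1 i = f B'.1 i := by
    rcases h with h | ⟨h1, h2⟩ <;> rcases h' with h' | ⟨h1', h2'⟩
    · omega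
    · omega
    · omega
    · exact fun i hi => le_antisymm (h2 i hi) (h2' i hi)
  -- `ε` depends only on the values of `f` on `[1, D]`, so its injectivity yields `B = B'`.
  refine eps_injective (funext fun j => ?_)
  unfold eps
  rw [hf j j.2]

/-! ### Unitriangular matrices over a finite partial order -/

section Triangular

variable {ι R : Type*} [Fintype ι] [PartialOrder ι] [CommRing R] {M : ι → ι → R}

lemma sum_mul_eq_of_triangular (hM : ∀ z y, M z y ≠ 0 → y ≤ z) (hM1 : ∀ z, M z z = 1)
    {a : ι → R} {y : ι} (ha : ∀ z, a z ≠ 0 → y ≤ z → z = y) : ∑ z, a z * M z y = a y := by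
  rw [Finset.sum_eq_single y, hM1, mul_one]
  · intro z _ hz
    by_contra h
    exact hz (ha z (left_ne_zero_of_mul h) (hM z y (right_ne_zero_of_mul h)))
  · simp

/-- At a maximal `y` in `P` with `a y ≠ 0`, upward closure of `P` leaves only the diagonal term, so
the column sum would be `a y`. Taking `P` to be everything gives independence; taking `¬ y ≤ x`
bounds the support of a row of the inverse. -/
lemma eq_zero_of_triangular (hM : ∀ z y, M z y ≠ 0 → y ≤ z) (hM1 : ∀ z, M z z = 1)
    {a : ι → R} {P : ι → Prop} (hP : ∀ y z, P y → y ≤ z → P z)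
    (ha : ∀ y, P y → ∑ z, a z * M z y = 0) : ∀ y, P y → a y = 0 := by
  by_contra! hc
  obtain ⟨y, hy⟩ := (Set.toFinite {y | P y ∧ a y ≠ 0}).exists_maximal hc
  refine hy.prop.2 ?_
  rw [← ha y hy.prop.1, sum_mul_eq_of_triangular hM hM1]
  exact fun z hz hyz => (hy.eq_of_le ⟨hP y z hy.prop.1 hyz, hz⟩ hyz).symm

end Triangular

end NewBasis

theorem theorem1p21 (D : ℕ) (hD : Even D) :
    ∃ e : NewBasis.S D ≃ NewBasis.V D,
      (∀ B, e B = NewBasis.eps B) ∧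
      (∃ b : Module.Basis (NewBasis.S D) ℂ (NewBasis.V D → ℂ), ∀ B, b B = NewBasis.Psi B) ∧
      IsPartialOrder (NewBasis.V D) (NewBasis.leV e) ∧
      (∃! c : NewBasis.V D → NewBasis.V D → ℂ, NewBasis.IsExpansion e c) ∧
      ∀ c : NewBasis.V D → NewBasis.V D → ℂ, NewBasis.IsExpansion e c →
        (∀ x x' : NewBasis.V D, c x x' ≠ 0 → NewBasis.leV e x' x) ∧
        ∀ x : NewBasis.V D, c x x = 1 := by
  classical
  let e : NewBasis.S D ≃ NewBasis.V D :=
    Equiv.ofBijective _ ⟨NewBasis.eps_injective, NewBasis.eps_surjective hD⟩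
  have he : ∀ x, NewBasis.eps (e.symm x) = x := e.apply_symm_apply
  let _ : PartialOrder (NewBasis.V D) :=
    { le := NewBasis.leV e
      le_refl := fun x => NewBasis.leS_refl _
      le_trans := fun x y z h h' => NewBasis.leS_trans h h'
      le_antisymm := fun x y h h' => e.symm.injective (NewBasis.leS_antisymm h h') }
  let M : NewBasis.V D → NewBasis.V D → ℂ := fun z y => NewBasis.Psi (e.symm z) y
  have hM : ∀ z y, M z y ≠ 0 → y ≤ z := by
    intro z y h
    have h' : y ∈ NewBasis.spanB (e.symm z) := Set.mem_of_indicator_ne_zero h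
    rw [← he y] at h'
    exact NewBasis.leS_of_eps_mem h'
  have hM1 : ∀ z, M z z = 1 := by
    intro z
    have h := NewBasis.eps_mem_spanB (e.symm z)
    rw [he] at h
    exact Set.indicator_of_mem (show z ∈ (NewBasis.spanB (e.symm z) : Set _) from h) 1
  have hli : LinearIndependent ℂ fun z => NewBasis.Psi (e.symm z) := by
    rw [Fintype.linearIndependent_iff]
    intro a ha y
    refine NewBasis.eq_zero_of_triangular (P := fun _ => True) hM hM1 (fun _ _ _ _ => trivial)
      (fun y _ => ?_) y trivial
    simpa using congrFun ha y
  -- Indexing the functions by `V` through `e` makes their number equal to the dimension.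
  let b := basisOfLinearIndependentOfCardEqFinrank hli (by simp)
  have hb : ∀ z, b z = NewBasis.Psi (e.symm z) := fun z => by simp [b]
  have hexp : ∀ c, NewBasis.IsExpansion e c ↔ ∀ x z, b.repr (NewBasis.psi x) z = c x z := by
    intro c
    refine forall_congr' fun x => ?_
    simp only [← hb]
    constructor
    · intro h z
      rw [h, b.repr_sum_self]
    · intro h
      simp only [← h]
      exact (b.sum_repr _).symm
  refine ⟨e, fun B => rfl, ⟨b.reindex e.symm, fun B => by simp [hb]⟩,
    { refl := fun _ => NewBasis.leS_refl _
      trans := fun _ _ _ h h' => NewBasis.leS_trans h h'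
      antisymm := fun _ _ h h' => e.symm.injective (NewBasis.leS_antisymm h h') },
    ⟨fun x z => b.repr (NewBasis.psi x) z, (hexp _).2 fun _ _ => rfl,
      fun c hc => funext₂ fun x z => ((hexp c).1 hc x z).symm⟩, fun c hc => ?_⟩
  have hsum : ∀ x y, ∑ z, c x z * M z y = if y = x then 1 else 0 := by
    intro x y
    have := congrFun (hc x) y
    simp only [NewBasis.psi, Set.indicator_apply, Set.mem_singleton_iff, Pi.one_apply,
      Finset.sum_apply, Pi.smul_apply, smul_eq_mul] at this
    exact this.symm
  have htri : ∀ x z, c x z ≠ 0 → z ≤ x := by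
    intro x z h
    by_contra hn
    refine h (NewBasis.eq_zero_of_triangular (P := fun y => ¬ y ≤ x) hM hM1
      (fun y z hy hyz hz => hy (hyz.trans hz)) (fun y hy => ?_) z hn)
    rw [hsum, if_neg]
    rintro rfl
    exact hy le_rfl
  refine ⟨htri, fun x => ?_⟩
  rw [← NewBasis.sum_mul_eq_of_triangular hM hM1 (a := c x) (y := x)
    fun z hz hxz => le_antisymm (htri x z hz) hxz, hsum, if_pos rfl]
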